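/- **Theorem (First Epsilon Theorem for $\mathrm{EC}_\varepsilon$).** Consider a first-order signature of function and predicate symbols of arbitrary arities, without identity. Terms and formulas of the language $L_\varepsilon$ are defined simultaneously: terms are built from variables by function symbols and by the clause that, if $A$ is a formula in which $x$ occurs free and does not occur bound, then $\varepsilon x\,A$ is a term, in which $x$ is bound; formulas are built from atomic formulas $P(t_1,\dots,t_n)$, $\top$ and $\bot$ by $\lnot,\land,\lor,\to,\leftrightarrow$ (there are no quantifiers). Expressions that differ only by a renaming of bound variables are identified. The elementary calculus $\mathrm{EC}$ has as axioms all propositional tautologies of the language without $\varepsilon$, and modus ponens as its only rule. The intensional $\varepsilon$-calculus $\mathrm{EC}_\varepsilon$ (without identity) has as axioms all propositional tautologies of $L_\varepsilon$ and all critical formulas $$A(t)\to A(\varepsilon x\,A(x)),$$ where $\varepsilon x\,A(x)$ and $t$ are terms of $L_\varepsilon$, and modus ponens as its only rule. If $E$ is a formula that contains no $\varepsilon$-terms and $E$ is provable in $\mathrm{EC}_\varepsilon$, then $E$ is provable in $\mathrm{EC}$, that is, without critical formulas. -/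

import Mathlib

/-! Syntax and proofs of the elementary calculus EC and the intensional epsilon calculus,
both without quantifiers and without identity.

Expressions are represented up to renaming of bound variables: free variables are named
(`var x`, `x : ℕ`), a bound variable is the number `k` of epsilon operators between it and the one
that binds it (`bvar k`), and `eps A` is the epsilon term whose operator binds the index `0`
of `A`. The symbols come from an arbitrary first-order signature; no relation symbol is treated as
identity. -/

universe u v

namespace EpsCalc

mutual

/-- Raw terms: a bound index may point outside the expression; see `Term.WF`. -/
inductive Term (L : FirstOrder.Language.{u, v}) : Type (max u v)
  | var (x : ℕ) : Term L
  | bvar (i : ℕ) : Term L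
  | func {k : ℕ} (f : L.Functions k) (ts : Fin k → Term L) : Term L
  | eps (A : Formula L) : Term L

/-- Raw formulas. -/
inductive Formula (L : FirstOrder.Language.{u, v}) : Type (max u v)
  | rel {k : ℕ} (R : L.Relations k) (ts : Fin k → Term L) : Formula L
  | verum : Formula L
  | falsum : Formula L
  | neg (A : Formula L) : Formula L
  | and (A B : Formula L) : Formula L
  | or (A B : Formula L) : Formula L
  | imp (A B : Formula L) : Formula L
  | iff (A B : Formula L) : Formula L

end

variable {L : FirstOrder.Language.{u, v}}

mutual

/-- The variable with bound index `n` (counted from outside the term) occurs in the term. -/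
def Term.Occurs : ℕ → Term L → Prop
  | _, .var _ => False
  | n, .bvar i => i = n
  | n, .func _ ts => ∃ i, (ts i).Occurs n
  | n, .eps A => A.Occurs (n + 1)

/-- The variable with bound index `n` (counted from outside the formula) occurs in it. -/
def Formula.Occurs : ℕ → Formula L → Prop
  | n, .rel _ ts => ∃ i, (ts i).Occurs n
  | _, .verum => False
  | _, .falsum => False
  | n, .neg A => A.Occurs n
  | n, .and A B => A.Occurs n ∨ B.Occurs n
  | n, .or A B => A.Occurs n ∨ B.Occurs n
  | n, .imp A B => A.Occurs n ∨ B.Occurs n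
  | n, .iff A B => A.Occurs n ∨ B.Occurs n

end

mutual

/-- Well-formedness below `n` binders: every index that is not bound inside the term is `< n`,
and every epsilon operator binds at least one occurrence of its variable.
The terms of the language are the raw terms `t` with `t.WF 0`. -/
def Term.WF : ℕ → Term L → Prop
  | _, .var _ => True
  | n, .bvar i => i < n
  | n, .func _ ts => ∀ i, (ts i).WF n
  | n, .eps A => A.WF (n + 1) ∧ A.Occurs 0

/-- Well-formedness below `n` binders.
The formulas of the language are the raw formulas `A` with `A.WF 0`. -/
def Formula.WF : ℕ → Formula L → Prop
  | n, .rel _ ts => ∀ i, (ts i).WF n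
  | _, .verum => True
  | _, .falsum => True
  | n, .neg A => A.WF n
  | n, .and A B => A.WF n ∧ B.WF n
  | n, .or A B => A.WF n ∧ B.WF n
  | n, .imp A B => A.WF n ∧ B.WF n
  | n, .iff A B => A.WF n ∧ B.WF n

end

mutual

/-- `Term.inst t n s` replaces the bound index `n` of `s` by `t`. It is used only for `t` with `t.WF 0`,
so that `t` has no loose index and nothing in it can be captured. -/
def Term.inst (t : Term L) : ℕ → Term L → Term L
  | _, .var x => .var x
  | n, .bvar i => if i = n then t else .bvar i
  | n, .func f ts => .func f fun i => Term.inst t n (ts i)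
  | n, .eps A => .eps (A.inst t (n + 1))

/-- `Formula.inst t n A` replaces the bound index `n` of `A` by `t`. -/
def Formula.inst (t : Term L) : ℕ → Formula L → Formula L
  | n, .rel R ts => .rel R fun i => Term.inst t n (ts i)
  | _, .verum => .verum
  | _, .falsum => .falsum
  | n, .neg A => .neg (A.inst t n)
  | n, .and A B => .and (A.inst t n) (B.inst t n)
  | n, .or A B => .or (A.inst t n) (B.inst t n)
  | n, .imp A B => .imp (A.inst t n) (B.inst t n)
  | n, .iff A B => .iff (A.inst t n) (B.inst t n)

end

/-- The term contains no epsilon term. -/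
def Term.EpsFree : Term L → Prop
  | .var _ => True
  | .bvar _ => True
  | .func _ ts => ∀ i, (ts i).EpsFree
  | .eps _ => False

/-- The formula contains no epsilon term. -/
def Formula.EpsFree : Formula L → Prop
  | .rel _ ts => ∀ i, (ts i).EpsFree
  | .verum => True
  | .falsum => True
  | .neg A => A.EpsFree
  | .and A B => A.EpsFree ∧ B.EpsFree
  | .or A B => A.EpsFree ∧ B.EpsFree
  | .imp A B => A.EpsFree ∧ B.EpsFree
  | .iff A B => A.EpsFree ∧ B.EpsFree

/-- Truth value of a formula when each atomic formula `R(t₁, …, tₖ)` has the truth value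
`v R t`. -/
def Formula.Holds (v : ∀ k : ℕ, L.Relations k → (Fin k → Term L) → Prop) : Formula L → Prop
  | .rel (k := k) R ts => v k R ts
  | .verum => True
  | .falsum => False
  | .neg A => ¬ A.Holds v
  | .and A B => A.Holds v ∧ B.Holds v
  | .or A B => A.Holds v ∨ B.Holds v
  | .imp A B => A.Holds v → B.Holds v
  | .iff A B => (A.Holds v ↔ B.Holds v)

/-- Propositional tautologies: true for all assignments of truth values to atomic formulas. -/
def Formula.Tautology (A : Formula L) : Prop :=
  ∀ v : ∀ k : ℕ, L.Relations k → (Fin k → Term L) → Prop, A.Holds v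

/-- Critical formulas `A(t) → A(ε x A(x))`, where `ε x A(x)` and `t` are terms of the language;
in particular `x` occurs in `A(x)`. -/
def Formula.Critical (C : Formula L) : Prop :=
  ∃ (A : Formula L) (t : Term L), (Term.eps A).WF 0 ∧ t.WF 0 ∧
    C = .imp (A.inst t 0) (A.inst (.eps A) 0)

/-- `π` is a proof from the axioms `Ax`: each formula of the sequence is an axiom or follows from
two earlier ones by modus ponens. -/
def IsProof (Ax : Set (Formula L)) {n : ℕ} (π : Fin n → Formula L) : Prop :=
  ∀ i, π i ∈ Ax ∨ ∃ j k, j < i ∧ k < i ∧ π k = .imp (π j) (π i)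

/-- There is a proof from the axioms `Ax` whose last formula is `A`. -/
def Provable (Ax : Set (Formula L)) (A : Formula L) : Prop :=
  ∃ (n : ℕ) (π : Fin (n + 1) → Formula L), IsProof Ax π ∧ π (Fin.last n) = A

/-- Provability in the elementary calculus EC, whose language has no epsilon operator: the axioms
are the tautologies of that language, and modus ponens is the only rule. -/
def ProvableEC (A : Formula L) : Prop :=
  Provable {B : Formula L | B.WF 0 ∧ B.EpsFree ∧ B.Tautology} A

/-- Provability in the intensional epsilon calculus without identity: the axioms are the tautologies
of the language with the epsilon operator and the critical formulas, and modus ponens is the only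
rule. -/
def ProvableECEps (A : Formula L) : Prop :=
  Provable {B : Formula L | (B.WF 0 ∧ B.Tautology) ∨ B.Critical} A

end EpsCalc

/-!
The proof is semantic. In a nonempty first-order structure an epsilon term `ε x A(x)` can be
interpreted extensionally: as a chosen element satisfying `A`, if there is one (`Term.value`,
`Formula.truthSet`). Under this interpretation tautologies hold because truth in a structure is a
truth assignment to the atomic formulas (`Formula.mem_truthSet_iff_holds`), and a critical formula
`A(t) → A(ε x A(x))` holds because, by the substitution lemma (`Formula.mem_truthSet_inst`),
`A(t)` says that the value of `t` satisfies `A`, so that the chosen element does as well. Hence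
everything provable in the epsilon calculus holds in every structure
(`ProvableECEps.mem_truthSet`).

Now let `E` be provable and free of epsilon terms, and let `v` be any truth assignment to the
atomic formulas. Let the terms themselves be the elements of a structure in which the function
symbols build terms and the relations are given by `v`. There a term without epsilon denotes
itself, so that truth of `E` in this structure is truth of `E` under `v`
(`Formula.mem_truthSet_herbrand`). So `E` is a tautology, hence an axiom of the elementary
calculus; that it is well formed follows from the well-formedness of all provable formulas
(`ProvableECEps.wf`).
-/

namespace EpsCalc

open FirstOrder.Language.Structure (funMap RelMap)

variable {L : FirstOrder.Language.{u, v}}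

/-- Every provable formula has any property that the axioms have and modus ponens preserves. -/
theorem Provable.induction {Ax : Set (Formula L)} {p : Formula L → Prop} (ax : ∀ A ∈ Ax, p A)
    (mp : ∀ A B, p (.imp A B) → p A → p B) {A : Formula L} (h : Provable Ax A) : p A := by
  obtain ⟨n, π, hπ, rfl⟩ := h
  have key : ∀ i, p (π i) := fun i => by
    induction i using WellFoundedLT.induction with
    | ind i ih =>
      rcases hπ i with hi | ⟨j, k, hj, hk, e⟩
      · exact ax _ hi
      · exact mp _ _ (e ▸ ih k hk) (ih j hj)
  exact key _

theorem Provable.of_mem {Ax : Set (Formula L)} {A : Formula L} (h : A ∈ Ax) : Provable Ax A :=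
  ⟨0, fun _ => A, fun _ => .inl h, rfl⟩

/-! ### Well-formedness of provable formulas -/

mutual

theorem Term.WF.mono {m n : ℕ} (hmn : m ≤ n) : ∀ {t : Term L}, t.WF m → t.WF n
  | .var _, _ => by simp [Term.WF]
  | .bvar _, h => by simp only [Term.WF] at h ⊢; omega
  | .func _ _, h => by
    simp only [Term.WF] at h ⊢
    exact fun i => (h i).mono hmn
  | .eps _, h => by
    simp only [Term.WF] at h ⊢
    exact ⟨h.1.mono (Nat.succ_le_succ hmn), h.2⟩

theorem Formula.WF.mono {m n : ℕ} (hmn : m ≤ n) : ∀ {A : Formula L}, A.WF m → A.WF n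
  | .rel _ _, h => by
    simp only [Formula.WF] at h ⊢
    exact fun i => (h i).mono hmn
  | .verum, _ => by simp [Formula.WF]
  | .falsum, _ => by simp [Formula.WF]
  | .neg _, h => by
    simp only [Formula.WF] at h ⊢
    exact h.mono hmn
  | .and _ _, h | .or _ _, h | .imp _ _, h | .iff _ _, h => by
    simp only [Formula.WF] at h ⊢
    exact ⟨h.1.mono hmn, h.2.mono hmn⟩

end

mutual

/-- Instantiating one index keeps the occurrences of every other one. For this reason an epsilon
operator inside the expression still binds something after the instantiation. -/
theorem Term.Occurs.inst (t : Term L) {m n : ℕ} (hmn : m ≠ n) :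
    ∀ {s : Term L}, s.Occurs m → (Term.inst t n s).Occurs m
  | .var _, h => by simp [Term.Occurs] at h
  | .bvar _, h => by
    simp only [Term.Occurs] at h
    subst h
    simp [Term.inst, hmn, Term.Occurs]
  | .func _ _, h => by
    simp only [Term.Occurs, Term.inst] at h ⊢
    exact h.imp fun _ hi => hi.inst t hmn
  | .eps _, h => by
    simp only [Term.Occurs, Term.inst] at h ⊢
    exact h.inst t (by omega)

theorem Formula.Occurs.inst (t : Term L) {m n : ℕ} (hmn : m ≠ n) :
    ∀ {A : Formula L}, A.Occurs m → (A.inst t n).Occurs m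
  | .rel _ _, h => by
    simp only [Formula.Occurs, Formula.inst] at h ⊢
    exact h.imp fun _ hi => hi.inst t hmn
  | .verum, h => by simp [Formula.Occurs] at h
  | .falsum, h => by simp [Formula.Occurs] at h
  | .neg _, h => by
    simp only [Formula.Occurs, Formula.inst] at h ⊢
    exact h.inst t hmn
  | .and _ _, h | .or _ _, h | .imp _ _, h | .iff _ _, h => by
    simp only [Formula.Occurs, Formula.inst] at h ⊢
    exact h.imp (fun h => h.inst t hmn) (fun h => h.inst t hmn)

end

mutual

theorem Term.WF.inst {t : Term L} (ht : t.WF 0) {n : ℕ} :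
    ∀ {s : Term L}, s.WF (n + 1) → (Term.inst t n s).WF n
  | .var _, _ => by simp [Term.WF, Term.inst]
  | .bvar i, h => by
    simp only [Term.WF, Term.inst] at h ⊢
    split_ifs
    · exact ht.mono (Nat.zero_le n)
    · simp only [Term.WF]
      omega
  | .func _ _, h => by
    simp only [Term.WF, Term.inst] at h ⊢
    exact fun i => Term.WF.inst ht (h i)
  | .eps _, h => by
    simp only [Term.WF, Term.inst] at h ⊢
    exact ⟨Formula.WF.inst ht h.1, h.2.inst t (Nat.succ_ne_zero n).symm⟩

theorem Formula.WF.inst {t : Term L} (ht : t.WF 0) {n : ℕ} :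
    ∀ {A : Formula L}, A.WF (n + 1) → (A.inst t n).WF n
  | .rel _ _, h => by
    simp only [Formula.WF, Formula.inst] at h ⊢
    exact fun i => Term.WF.inst ht (h i)
  | .verum, _ => by simp [Formula.WF, Formula.inst]
  | .falsum, _ => by simp [Formula.WF, Formula.inst]
  | .neg _, h => by
    simp only [Formula.WF, Formula.inst] at h ⊢
    exact Formula.WF.inst ht h
  | .and _ _, h | .or _ _, h | .imp _ _, h | .iff _ _, h => by
    simp only [Formula.WF, Formula.inst] at h ⊢
    exact ⟨Formula.WF.inst ht h.1, Formula.WF.inst ht h.2⟩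

end

theorem Formula.Critical.wf {C : Formula L} (h : C.Critical) : C.WF 0 := by
  obtain ⟨A, t, hA, ht, rfl⟩ := h
  have hA' : A.WF 1 := by
    simp only [Term.WF] at hA
    exact hA.1
  simp only [Formula.WF]
  exact ⟨hA'.inst ht, hA'.inst hA⟩

theorem ProvableECEps.wf {A : Formula L} (h : ProvableECEps A) : A.WF 0 := by
  refine Provable.induction (p := fun A => A.WF 0) ?_ (fun A B hAB _ => ?_) h
  · rintro A (hA | hA)
    exacts [hA.1, hA.wf]
  · simp only [Formula.WF] at hAB
    exact hAB.2

/-! ### Extensional semantics of the epsilon operator -/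

section Semantics

variable {M : Type*}

/-- The environment that gives the bound index `0` the value `d` and moves the values of `e` up by
one, as needed below one more binder. -/
def push (d : M) (e : ℕ → M) : ℕ → M
  | 0 => d
  | i + 1 => e i

theorem push_update (d a : M) (e : ℕ → M) (n : ℕ) :
    push d (Function.update e n a) = Function.update (push d e) (n + 1) a := by
  funext i
  cases i <;> simp [push, Function.update_apply]

variable [L.Structure M] [Nonempty M] (x : ℕ → M)

mutual

/-- The value of a term in a structure, where `x` assigns values to the free variables, as a
function of the environment `e` that assigns values to the loose bound indices. The value of
`ε x A(x)` is an element satisfying `A`, if there is one; it depends only on the set of these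
elements. -/
noncomputable def Term.value : Term L → (ℕ → M) → M
  | .var i => fun _ => x i
  | .bvar i => fun e => e i
  | .func f ts => fun e => funMap f fun i => (ts i).value e
  | .eps A => fun e => Classical.epsilon fun d => push d e ∈ A.truthSet

/-- The environments in which a formula is true in a structure, where `x` assigns values to the
free variables. Truth is encoded as a set of environments, and not as a predicate, because the
types of the two functions of this mutual recursion have to lie in the same universe. -/
noncomputable def Formula.truthSet : Formula L → Set (ℕ → M)
  | .rel R ts => {e | RelMap R fun i => (ts i).value e}
  | .verum => {_e | True}
  | .falsum => {_e | False}
  | .neg A => {e | e ∉ A.truthSet}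
  | .and A B => {e | e ∈ A.truthSet ∧ e ∈ B.truthSet}
  | .or A B => {e | e ∈ A.truthSet ∨ e ∈ B.truthSet}
  | .imp A B => {e | e ∈ A.truthSet → e ∈ B.truthSet}
  | .iff A B => {e | e ∈ A.truthSet ↔ e ∈ B.truthSet}

end

mutual

theorem Term.value_congr {n : ℕ} {e e' : ℕ → M} (he : ∀ i < n, e i = e' i) :
    ∀ {t : Term L}, t.WF n → t.value x e = t.value x e'
  | .var _, _ => by simp only [Term.value]
  | .bvar i, h => by
    simp only [Term.WF] at h
    simp only [Term.value, he i h]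
  | .func _ _, h => by
    simp only [Term.WF] at h
    simp only [Term.value]
    congr 1
    exact funext fun i => Term.value_congr he (h i)
  | .eps A, h => by
    simp only [Term.WF] at h
    simp only [Term.value]
    congr 1
    refine funext fun d => propext (Formula.mem_truthSet_congr (n := n + 1) ?_ h.1)
    rintro (_ | i) hi
    · rfl
    · exact he i (Nat.lt_of_succ_lt_succ hi)

theorem Formula.mem_truthSet_congr {n : ℕ} {e e' : ℕ → M} (he : ∀ i < n, e i = e' i) :
    ∀ {A : Formula L}, A.WF n → (e ∈ A.truthSet x ↔ e' ∈ A.truthSet x)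
  | .rel R ts, h => by
    simp only [Formula.WF] at h
    have : (fun i => (ts i).value x e) = fun i => (ts i).value x e' :=
      funext fun i => Term.value_congr he (h i)
    simp only [Formula.truthSet, Set.mem_ofPred_eq, this]
  | .verum, _ => by simp only [Formula.truthSet, Set.mem_ofPred_eq]
  | .falsum, _ => by simp only [Formula.truthSet, Set.mem_ofPred_eq]
  | .neg _, h => by
    simp only [Formula.WF] at h
    simp only [Formula.truthSet, Set.mem_ofPred_eq, Formula.mem_truthSet_congr he h]
  | .and _ _, h | .or _ _, h | .imp _ _, h | .iff _ _, h => by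
    simp only [Formula.WF] at h
    simp only [Formula.truthSet, Set.mem_ofPred_eq, Formula.mem_truthSet_congr he h.1,
      Formula.mem_truthSet_congr he h.2]

end

mutual

theorem Term.value_inst {t : Term L} {a : M} (ha : ∀ e, t.value x e = a) (n : ℕ)
    (e : ℕ → M) : ∀ s : Term L,
    (Term.inst t n s).value x e = s.value x (Function.update e n a)
  | .var _ => by simp only [Term.inst, Term.value]
  | .bvar i => by
    by_cases hi : i = n
    · simp [Term.inst, Term.value, hi, ha]
    · simp [Term.inst, Term.value, hi]
  | .func _ ts => by
    simp only [Term.inst, Term.value]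
    congr 1
    exact funext fun i => Term.value_inst ha n e (ts i)
  | .eps A => by
    simp only [Term.inst, Term.value]
    congr 1
    funext d
    rw [push_update, Formula.mem_truthSet_inst ha (n + 1) (push d e) A]

/-- The substitution lemma: instantiating a bound index with a term amounts to giving it the value
of this term, which does not depend on the environment. -/
theorem Formula.mem_truthSet_inst {t : Term L} {a : M} (ha : ∀ e, t.value x e = a) (n : ℕ)
    (e : ℕ → M) : ∀ A : Formula L,
    e ∈ (A.inst t n).truthSet x ↔ Function.update e n a ∈ A.truthSet x
  | .rel R ts => by
    have : (fun i => (Term.inst t n (ts i)).value x e) =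
        fun i => (ts i).value x (Function.update e n a) :=
      funext fun i => Term.value_inst ha n e (ts i)
    simp only [Formula.inst, Formula.truthSet, Set.mem_ofPred_eq, this]
  | .verum => by simp only [Formula.inst, Formula.truthSet, Set.mem_ofPred_eq]
  | .falsum => by simp only [Formula.inst, Formula.truthSet, Set.mem_ofPred_eq]
  | .neg A => by
    simp only [Formula.inst, Formula.truthSet, Set.mem_ofPred_eq,
      Formula.mem_truthSet_inst ha n e A]
  | .and A B | .or A B | .imp A B | .iff A B => by
    simp only [Formula.inst, Formula.truthSet, Set.mem_ofPred_eq,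
      Formula.mem_truthSet_inst ha n e A, Formula.mem_truthSet_inst ha n e B]

end

theorem Formula.mem_truthSet_iff_holds (e : ℕ → M) : ∀ A : Formula L,
    e ∈ A.truthSet x ↔ A.Holds fun _ R ts => RelMap R fun i => (ts i).value x e
  | .rel _ _ | .verum | .falsum => by simp only [Formula.truthSet, Set.mem_ofPred_eq, Formula.Holds]
  | .neg A => by
    simp only [Formula.truthSet, Set.mem_ofPred_eq, Formula.Holds,
      Formula.mem_truthSet_iff_holds e A]
  | .and A B | .or A B | .imp A B | .iff A B => by
    simp only [Formula.truthSet, Set.mem_ofPred_eq, Formula.Holds,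
      Formula.mem_truthSet_iff_holds e A, Formula.mem_truthSet_iff_holds e B]

theorem Formula.Critical.mem_truthSet {C : Formula L} (h : C.Critical) (e : ℕ → M) :
    e ∈ C.truthSet x := by
  obtain ⟨A, t, hA, ht, rfl⟩ := h
  have value_const {s : Term L} (hs : s.WF 0) (e' : ℕ → M) : s.value x e' = s.value x e :=
    Term.value_congr x (fun _ hi => absurd hi (Nat.not_lt_zero _)) hs
  have hA' : A.WF 1 := by
    simp only [Term.WF] at hA
    exact hA.1
  -- `A` has no loose index other than `0`, so replacing the value of `0` is as good as pushing.
  have update_iff (a : M) : Function.update e 0 a ∈ A.truthSet x ↔ push a e ∈ A.truthSet x := by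
    refine Formula.mem_truthSet_congr x (fun i hi => ?_) hA'
    obtain rfl : i = 0 := by omega
    simp [push]
  simp only [Formula.truthSet, Set.mem_ofPred_eq]
  rw [Formula.mem_truthSet_inst x (value_const ht), Formula.mem_truthSet_inst x (value_const hA),
    update_iff, update_iff]
  intro h
  simp only [Term.value]
  exact Classical.epsilon_spec (p := fun d => push d e ∈ A.truthSet x) ⟨_, h⟩

/-- Soundness: what the epsilon calculus proves is true in every nonempty structure. -/
theorem ProvableECEps.mem_truthSet {A : Formula L} (h : ProvableECEps A) (e : ℕ → M) :
    e ∈ A.truthSet x := by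
  refine Provable.induction (p := fun A => e ∈ A.truthSet x) ?_ (fun A B hAB hA => ?_) h
  · rintro A (hA | hA)
    exacts [(A.mem_truthSet_iff_holds x e).2 (hA.2 _), hA.mem_truthSet x e]
  · simp only [Formula.truthSet, Set.mem_ofPred_eq] at hAB
    exact hAB hA

end Semantics

/-! ### The term structure of a truth assignment -/

section Herbrand

variable (v : ∀ k : ℕ, L.Relations k → (Fin k → Term L) → Prop)

/-- The structure whose elements are the raw terms, in which function symbols build terms and the
relations hold as the truth assignment `v` says. -/
abbrev herbrand : L.Structure (Term L) where
  funMap f ts := .func f ts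
  RelMap R ts := v _ R ts

instance : Nonempty (Term L) := ⟨.var 0⟩

/-- Epsilon-free terms denote themselves. Since the environment `Term.bvar` gives every loose
index itself as its value, this needs no well-formedness. -/
theorem Term.value_herbrand : ∀ {t : Term L}, t.EpsFree →
    letI := herbrand v; t.value Term.var Term.bvar = t
  | .var _, _ | .bvar _, _ => by simp only [Term.value]
  | .func f ts, h => by
    simp only [Term.EpsFree] at h
    simp only [Term.value]
    exact congrArg (Term.func f) (funext fun i => Term.value_herbrand (h i))
  | .eps _, h => by simp [Term.EpsFree] at h

theorem Formula.mem_truthSet_herbrand : ∀ {A : Formula L}, A.EpsFree →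
    letI := herbrand v; ((Term.bvar : ℕ → Term L) ∈ A.truthSet Term.var ↔ A.Holds v)
  | .rel R ts, h => by
    simp only [Formula.EpsFree] at h
    simp only [Formula.truthSet, Set.mem_ofPred_eq, Formula.Holds, Term.value_herbrand v (h _)]
    exact Iff.rfl
  | .verum, _ | .falsum, _ => by simp only [Formula.truthSet, Set.mem_ofPred_eq, Formula.Holds]
  | .neg _, h => by
    simp only [Formula.EpsFree] at h
    simp only [Formula.truthSet, Set.mem_ofPred_eq, Formula.Holds, Formula.mem_truthSet_herbrand h]
  | .and _ _, h | .or _ _, h | .imp _ _, h | .iff _ _, h => by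
    simp only [Formula.EpsFree] at h
    simp only [Formula.truthSet, Set.mem_ofPred_eq, Formula.Holds,
      Formula.mem_truthSet_herbrand h.1, Formula.mem_truthSet_herbrand h.2]

end Herbrand

end EpsCalc

theorem mainTheorem2 {L : FirstOrder.Language.{u, v}} (E : EpsCalc.Formula L)
    (hE : E.EpsFree) (h : EpsCalc.ProvableECEps E) : EpsCalc.ProvableEC E := by
  refine EpsCalc.Provable.of_mem ⟨h.wf, hE, fun v => ?_⟩
  let := EpsCalc.herbrand v
  exact (EpsCalc.Formula.mem_truthSet_herbrand v hE).1 (h.mem_truthSet _ _)
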